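/- **Conventions.** Let $\lambda$ be a regular uncountable cardinal, identified with the set of ordinals below it. $\mathcal H(\lambda)$ is the set of sets hereditarily of cardinality $<\lambda$. Let $D$ be $2=\{0,1\}$ or $\mathcal H(\lambda)$; for a sequence $\eta$, $\mathrm{lh}(\eta)$ is its length and $\trianglelefteq$ means "is an initial segment of". A $\theta$-colouring with domain ${}^{<\lambda}D=\bigcup_{\alpha<\lambda}{}^{\alpha}D$ is a function $F:{}^{<\lambda}D\to\theta$. "Colouring" means $2$-colouring. For $S\subseteq\lambda$, an *$F$-weak diamond sequence for $S$* is an $\eta\in{}^S\theta$ such that for every $f\in{}^\lambda D$ the set $\{\delta\in S:\eta(\delta)=F(f{\restriction}\delta)\}$ is stationary in $\lambda$. The diagonal union of $\langle A_\xi:\xi<\lambda\rangle$ is $\{\delta<\lambda:(\exists\xi<\delta)\,\delta\in A_\xi\}$. **Families attached to a colouring $F$.** * $\mathfrak B(F)$ is the family of all $S\subseteq\lambda$ such that for some $f\in{}^\lambda D$, for all $\alpha<\lambda$: $\alpha\in S\iff F(f{\restriction}(1+\alpha))=1$. * $\mathfrak B^+(F)$ is the closure of $\mathfrak B(F)\cup\{S\subseteq\lambda:S\text{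 is not stationary}\}$ under unions of fewer than $\lambda$ sets, complements and diagonal unions. * For $\mathcal A\subseteq\mathcal P(\lambda)$, $\mathrm{ideal}_\lambda(\mathcal A)$ is the smallest family containing $\mathcal A$ and all singletons that is closed under subsets, unions of fewer than $\lambda$ sets and diagonal unions. $\mathrm{ID}_0(F)$ is the family of nonstationary subsets of $\lambda$. $\mathrm{ID}_{\beta+1}(F)$ is $\mathrm{ideal}_\lambda$ of the family of all $S\subseteq\lambda$ such that for each $S^*\subseteq S$ there is $f\in{}^\lambda D$ with $\{\delta<\lambda:\delta\in S^*\Leftrightarrow F(f{\restriction}\delta)=0\}\in\mathrm{ID}_\beta(F)$. For limit $\alpha$, $\mathrm{ID}_\alpha(F)=\mathrm{ideal}_\lambda(\bigcup_{\beta<\alpha}\mathrm{ID}_\beta(F))$. Finally $\mathrm{ID}(F)=\bigcup_\alpha\mathrm{ID}_\alpha(F)$. * $\mathrm{ID}^1(F)=\{S\subseteq\lambda:(\exists X\in\mathfrak B^+(F))(S\subseteq X\ \&\ \mathcal P(X)\subseteq\mathfrak B^+(F))\}$. * $\mathrm{ID}^2(F)$ is the family of all $S\subseteq\lambda$ such that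 for some $X\in\mathfrak B^+(F)$ with $S\subseteq X$ there is a partition of $X$ into (possibly empty) sets $X_0,X_1$ such that $(\alpha)$ $\mathcal P(X_\ell)=\{Y\cap X_\ell:Y\in\mathfrak B^+(F)\}$ for $\ell=0,1$, and $(\beta)$ there are no $Y\in\mathfrak B^+(F)$ and $\ell<2$ with $Y\setminus X_\ell\in\mathrm{ID}^1(F)$ and $Y\notin\mathrm{ID}^1(F)$. **The relation $F_1\le F_2$** between colourings $F_1,F_2$ of ${}^{<\lambda}2$ means that there is $h:{}^{<\lambda}2\to{}^{<\lambda}2$ such that (a) $\eta\trianglelefteq\nu$ implies $h(\eta)\trianglelefteq h(\nu)$; (b) $h(\eta)=\lim_{\alpha<\delta}h(\eta{\restriction}\alpha)$ whenever $\delta=\mathrm{lh}(\eta)$ is a limit ordinal; (c) if $0<\mathrm{lh}(\eta)=\mathrm{lh}(h(\eta))$ then $F_1(\eta)=F_2(h(\eta))$; (d) if $\eta\in{}^\lambda2$ and $\lim_{\alpha<\lambda}h(\eta{\restriction}\alpha)$ has length $<\lambda$, then $F_1(\eta{\restriction}\alpha)=0$ for all large enough $\alpha<\lambda$. **The colouring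 $F^\otimes$.** Let $F$ be a colouring of ${}^{<\lambda}2$. A sequence $g\in{}^\gamma(\mathcal H(\lambda))$, $\gamma<\lambda$, is *standard* if it has a witness $(T,\bar f,\bar\ell,\bar\alpha,\bar A)$: $T$ is a nonempty set of finite sequences of ordinals $<\gamma$, closed under initial segments and without $\omega$-branches, and for $\eta\in T$ there are $f_\eta\in{}^\gamma2$, $\ell_\eta:{}^3\{0,1\}\to\{0,1\}$, $\alpha_\eta<\lambda$ and $A_\eta\subseteq\alpha_\eta$ such that for all $\beta<\gamma$, writing $T_\beta$ for the set of those $\eta\in T$ with all entries $<\beta$, $$g(\beta)=\big(T_\beta,\langle f_\eta{\restriction}\beta:\eta\in T_\beta\rangle,\langle\ell_\eta:\eta\in T_\beta\rangle,\langle\alpha_\eta:\eta\in T_\beta\rangle,\langle A_\eta:\eta\in T_\beta\rangle\big).$$ Given a witness, define $\mathbf t(\eta)\in\{0,1\}$ for $\eta\in T$ by downward recursion: if $\eta$ is maximal in $T$ or $1+\gamma<\alpha_\eta$, then $\mathbf t(\eta)=1\iff\gamma\in A_\eta$; otherwise $$\mathbf t(\eta)=\ell_\eta\big(F(f_\eta),\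 \max_\beta\mathbf t(\eta^\frown\langle\beta\rangle),\ \min_\beta\mathbf t(\eta^\frown\langle\beta\rangle)\big),$$ where $\beta$ ranges over the ordinals $<\gamma$ with $\eta^\frown\langle\beta\rangle\in T$. The colouring $F^\otimes$ of ${}^{<\lambda}\mathcal H(\lambda)$ is given by $F^\otimes(g)=\mathbf t(\langle\rangle)$ if $\mathrm{lh}(g)>0$ and $g$ is standard, and $F^\otimes(g)=0$ otherwise. (For $g$ of limit length the value does not depend on the witness; for $g$ of successor length it may, and the theorem holds for every choice.) **Theorem 2.6.** Let $\lambda$ be a regular uncountable cardinal and $F^{\rm tr}:{}^{<\lambda}2\to3$. For $i<3$ let $F_i:{}^{<\lambda}2\to\{0,1\}$ be given by $F_i(\eta)=1\iff F^{\rm tr}(\eta)=i$. Let $F:{}^{<\lambda}2\to\{0,1\}$ be such that $F_i\le F$ for all $i<3$. Assume that $\lambda\notin\mathrm{ID}^2(F^\otimes)$ and that $\mathrm{ID}(F^\otimes)$ is $\lambda^+$-saturated, i.e. there is no sequence $\langle A_\alpha:\alpha<\lambda^+\rangle$ of subsets of $\lambda$ such that $A_\alpha\notin\mathrm{ID}(F^\otimes)$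 for all $\alpha$ and $|A_\alpha\cap A_\beta|<\lambda$ for all $\alpha<\beta<\lambda^+$. Then there is an $F^{\rm tr}$-weak diamond sequence for $\lambda$, and moreover there is one for every $S\in\mathfrak B(F^\otimes)\setminus\mathrm{ID}^2(F^\otimes)$. -/

import Mathlib

universe u v w

open Set Cardinal Ordinal

namespace WeakDiamond

noncomputable section

open scoped Classical

/-- The set of ordinals below `α`, i.e. the von Neumann ordinal `α`. -/
abbrev Below (α : Ordinal.{u}) : Type (u + 1) := Set.Iio α

/-! Throughout, a cardinal `κ` is identified with its initial ordinal `κ.ord`; subsets of `κ` are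
terms of `Set (Below κ.ord)`. The colours `2` and `3` are `Fin 2` and `Fin 3`. -/

/-- `⋃_{α < κ} ^αX`: sequences of elements of `X` of length less than `κ`. -/
abbrev Dom (κ : Cardinal.{u}) (X : Type v) : Type (max (u + 1) v) :=
  Σ α : Below κ.ord, (Below α.1 → X)

variable {κ : Cardinal.{u}} {X : Type v} {Y : Type w}

/-- The length of a sequence. -/
abbrev lh (s : Dom κ X) : Ordinal.{u} := s.1.1

/-- `f ↾ δ`, for a sequence `f` of length `κ` and `δ < κ`. -/
def restr (f : Below κ.ord → X) (δ : Below κ.ord) : Dom κ X :=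
  ⟨δ, fun i => f ⟨i.1, lt_trans (Set.mem_Iio.1 i.2) (Set.mem_Iio.1 δ.2)⟩⟩

/-- `η ↾ δ`, for a sequence `η` of length less than `κ` and `δ < lh η`. -/
def Dom.restr (η : Dom κ X) (δ : Below (lh η)) : Dom κ X :=
  ⟨⟨δ.1, lt_trans (Set.mem_Iio.1 δ.2) (Set.mem_Iio.1 η.1.2)⟩, fun i => η.2 ⟨i.1, lt_trans (Set.mem_Iio.1 i.2) (Set.mem_Iio.1 δ.2)⟩⟩

/-- `s ⊴ t`: the sequence `s` is a (not necessarily proper) initial segment of `t`. -/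
def InitSeg (s t : Dom κ X) : Prop :=
  ∃ h : lh s ≤ lh t, ∀ i : Below (lh s), s.2 i = t.2 ⟨i.1, lt_of_lt_of_le (Set.mem_Iio.1 i.2) h⟩

/-! ### Weak diamond sequences, coded sets -/

/-- `η : S → θ` is an `F`-weak diamond sequence for `S ⊆ κ`. -/
def IsWeakDiamond {θ : Type*} (F : Dom κ X → θ) (S : Set (Below κ.ord)) (η : S → θ) : Prop :=
  ∀ f : Below κ.ord → X, IsStationary {δ | ∃ h : δ ∈ S, η ⟨δ, h⟩ = F (restr f δ)}

/-- The family `𝔅(F)` of the subsets of `κ` coded by a colouring `F` with two colours: `S` is coded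
by `F` if for some `f` of length `κ`, for all `α < κ`, `α ∈ S ↔ F (f ↾ (1 + α)) = 1`. -/
def coded (F : Dom κ X → Fin 2) : Set (Set (Below κ.ord)) :=
  {S | ∃ f : Below κ.ord → X, ∀ α β : Below κ.ord, β.1 = 1 + α.1 →
    (α ∈ S ↔ F (restr f β) = 1)}

/-- The diagonal union `{δ < κ : ∃ ξ < δ, δ ∈ A ξ}`. -/
def diagUnion (A : Below κ.ord → Set (Below κ.ord)) : Set (Below κ.ord) :=
  {δ | ∃ ξ, ξ < δ ∧ δ ∈ A ξ}

/-! ### The ideals `ID_α(F)` and `ID(F)` -/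

/-- The `κ`-complete normal ideal on `κ` generated by `𝒜` (possibly improper). -/
inductive idealGen (𝒜 : Set (Set (Below κ.ord))) : Set (Below κ.ord) → Prop
  | basic (S) : S ∈ 𝒜 → idealGen 𝒜 S
  | singleton (α) : idealGen 𝒜 {α}
  | subset (S S') : S' ⊆ S → idealGen 𝒜 S → idealGen 𝒜 S'
  | iUnion (μ : Below κ.ord) (A : Below μ.1 → Set (Below κ.ord)) :
      (∀ i, idealGen 𝒜 (A i)) → idealGen 𝒜 (⋃ i, A i)
  | diag (A : Below κ.ord → Set (Below κ.ord)) :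
      (∀ i, idealGen 𝒜 (A i)) → idealGen 𝒜 (diagUnion A)

/-- The nonstationary subsets of `κ`. -/
def nonstat (κ : Cardinal.{u}) : Set (Set (Below κ.ord)) := {S | ¬ IsStationary S}

/-- `ID⁻_{β+1}(F)`, as a function of `J = ID_β(F)`. -/
def idMinus (F : Dom κ X → Fin 2) (J : Set (Set (Below κ.ord))) : Set (Set (Below κ.ord)) :=
  {S | ∀ S' ⊆ S, ∃ f : Below κ.ord → X, {δ | δ ∈ S' ↔ F (restr f δ) = 0} ∈ J}

/-- The increasing hierarchy `ID_α(F)`. -/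
def idLevel (F : Dom κ X → Fin 2) (α : Ordinal.{u}) : Set (Set (Below κ.ord)) :=
  Ordinal.limitRecOn (motive := fun _ => Set (Set (Below κ.ord))) α
    (nonstat κ)
    (fun _ J => {S | idealGen (idMinus F J) S})
    (fun α _ J => {S | idealGen (⋃ β : Below α, J β.1 β.2) S})

/-- `ID(F) = ⋃_α ID_α(F)`. -/
def ID (F : Dom κ X → Fin 2) : Set (Set (Below κ.ord)) := ⋃ α : Ordinal.{u}, idLevel F α

/-- `κ⁺`-saturation: there is no `⟨A_α : α < κ⁺⟩` with all `A_α ∉ J` and `‖A_α ∩ A_β‖ < κ` for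
`α < β < κ⁺`. -/
def IsSaturated (J : Set (Set (Below κ.ord))) : Prop :=
  ¬ ∃ A : Below (Order.succ κ).ord → Set (Below κ.ord),
    (∀ α, A α ∉ J) ∧ ∀ α β, α < β → #(A α ∩ A β : Set (Below κ.ord)) < Cardinal.lift.{u + 1} κ

/-! ### `𝔅⁺(F)`, `ID¹(F)` and `ID²(F)` -/

/-- `𝔅⁺(F)`: the closure of `𝔅(F)` together with the nonstationary sets under unions of fewer
than `κ` sets, complements and diagonal unions. -/
inductive codedPlus (F : Dom κ X → Fin 2) : Set (Below κ.ord) → Prop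
  | basic (S) : S ∈ coded F → codedPlus F S
  | null (S) : S ∈ nonstat κ → codedPlus F S
  | compl (S) : codedPlus F S → codedPlus F Sᶜ
  | iUnion (μ : Below κ.ord) (A : Below μ.1 → Set (Below κ.ord)) :
      (∀ i, codedPlus F (A i)) → codedPlus F (⋃ i, A i)
  | diag (A : Below κ.ord → Set (Below κ.ord)) :
      (∀ i, codedPlus F (A i)) → codedPlus F (diagUnion A)

/-- `ID¹(F)`. -/
def ID1 (F : Dom κ X → Fin 2) : Set (Set (Below κ.ord)) :=
  {S | ∃ Z, codedPlus F Z ∧ S ⊆ Z ∧ ∀ Y ⊆ Z, codedPlus F Y}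

/-- `ID²(F)`. -/
def ID2 (F : Dom κ X → Fin 2) : Set (Set (Below κ.ord)) :=
  {S | ∃ Z, codedPlus F Z ∧ S ⊆ Z ∧ ∃ P : Fin 2 → Set (Below κ.ord),
    P 0 ∪ P 1 = Z ∧ Disjoint (P 0) (P 1) ∧
    (∀ l, {W | W ⊆ P l} = {W | ∃ Y, codedPlus F Y ∧ W = Y ∩ P l}) ∧
    ¬ ∃ Y, codedPlus F Y ∧ ∃ l, Y \ P l ∈ ID1 F ∧ Y ∉ ID1 F}

/-! ### The order of colourings -/

/-- `F₁ ≤ F₂`. In the last clause, the length of `lim_{α < κ} h (η ↾ α)` is the supremum of the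
lengths of the `h (η ↾ α)`. -/
def ColLE (F₁ : Dom κ X → Fin 2) (F₂ : Dom κ Y → Fin 2) : Prop :=
  ∃ h : Dom κ X → Dom κ Y,
    (∀ η ν, InitSeg η ν → InitSeg (h η) (h ν)) ∧
    -- At limits `h η` is the limit (union) of the `h (η ↾ α)`, which are initial segments of it.
    (∀ η, Order.IsSuccLimit (lh η) → ∀ ξ < lh (h η), ∃ α, ξ < lh (h (η.restr α))) ∧
    (∀ η, 0 < lh η → lh η = lh (h η) → F₁ η = F₂ (h η)) ∧
    (∀ η : Below κ.ord → X, (∃ ζ < κ.ord, ∀ α, lh (h (restr η α)) ≤ ζ) →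
      ∃ α₀ : Below κ.ord, ∀ α, α₀ ≤ α → F₁ (restr η α) = 0)

/-- The indicator colouring of the colour `i`. -/
def colourInd {n : ℕ} (F : Dom κ X → Fin n) (i : Fin n) : Dom κ X → Fin 2 :=
  fun η => if F η = i then 1 else 0

/-! ### The set `ℋ(κ)` and the coding of tuples as sets -/

/-- `ℋ(κ)`: the sets that are hereditarily of cardinality less than `κ`. -/
abbrev HSet (κ : Cardinal.{u}) : Type (u + 1) :=
  {x : ZFSet.{u} // x.Hereditarily fun y => y.card < κ}

/-- The function `{(a i, b i) : i ∈ ι}` as a set of ordered pairs. -/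
def zfGraph {ι : Type*} [Small.{u} ι] (a b : ι → ZFSet.{u}) : ZFSet.{u} :=
  ZFSet.range fun i => ZFSet.pair (a i) (b i)

/-- A natural number as a set. -/
def zfNat (n : ℕ) : ZFSet.{u} := (n : Ordinal.{u}).toZFSet

/-- A finite sequence of ordinals as a set. -/
def zfList (η : List Ordinal.{u}) : ZFSet.{u} :=
  zfGraph (fun i : Fin η.length => zfNat i) (fun i => (η.get i).toZFSet)

/-- A sequence of `0`s and `1`s of length `β` as a set. -/
def zfSeq {β : Ordinal.{u}} (s : Below β → Fin 2) : ZFSet.{u} :=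
  zfGraph (fun i : Below β => i.1.toZFSet) (fun i => zfNat (s i))

/-- A function `³{0,1} → {0,1}` as a set. -/
def zfTruth (l : Fin 2 → Fin 2 → Fin 2 → Fin 2) : ZFSet.{u} :=
  zfGraph (fun p : Fin 2 × Fin 2 × Fin 2 =>
      zfGraph (fun i : Fin 3 => zfNat i) (fun i => zfNat (![p.1, p.2.1, p.2.2] i)))
    (fun p => zfNat (l p.1 p.2.1 p.2.2))

/-- A set of ordinals below `α` as a set. -/
def zfSub (α : Ordinal.{u}) (A : Set Ordinal.{u}) : ZFSet.{u} :=
  ZFSet.range fun x : {x : Below α // x.1 ∈ A} => x.1.1.toZFSet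

/-- Quintuples as iterated ordered pairs. -/
def zfTuple5 (a b c d e : ZFSet.{u}) : ZFSet.{u} :=
  a.pair (b.pair (c.pair (d.pair e)))

/-! ### The colouring `F^⊗` -/

/-- `ν` is an immediate successor of `η` in the tree `T`. -/
def Child (T : Set (List Ordinal.{u})) (ν η : List Ordinal.{u}) : Prop :=
  ν ∈ T ∧ ∃ β, ν = η ++ [β]

/-- `T ∩ ^{<ω}β`. -/
abbrev TreeBelow (T : Set (List Ordinal.{u})) (β : Ordinal.{u}) : Type (u + 1) :=
  {η : List (Below β) // η.map Subtype.val ∈ T}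

/-- The finite sequence of ordinals underlying an element of `T ∩ ^{<ω}β`. -/
def TreeBelow.seq {T : Set (List Ordinal.{u})} {β : Ordinal.{u}} (η : TreeBelow T β) :
    List Ordinal.{u} := η.1.map Subtype.val

/-- A witness `(T, f̄, ℓ̄, ᾱ, Ā)` that `g ∈ ^γ(ℋ(κ))` is `F^⊗`-standard, for `F` with domain `^{<κ}2`.
Only the values of `f, l, a, A` on `T` matter. -/
structure Witness {κ : Cardinal.{u}} (γ : Below κ.ord) (g : Below γ.1 → HSet κ) where
  /-- the tree -/
  T : Set (List Ordinal.{u})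
  lt_of_mem : ∀ η ∈ T, ∀ x ∈ η, x < γ.1
  nil_mem : [] ∈ T
  mem_of_prefix : ∀ η ∈ T, ∀ ν, ν <+: η → ν ∈ T
  /-- the tree has no `ω`-branch -/
  wf : WellFounded (Child T)
  /-- the sequences `f_η ∈ ^γ2` -/
  f : List Ordinal.{u} → Below γ.1 → Fin 2
  /-- the functions `ℓ_η` -/
  l : List Ordinal.{u} → Fin 2 → Fin 2 → Fin 2 → Fin 2
  /-- the ordinals `α_η` -/
  a : List Ordinal.{u} → Ordinal.{u}
  a_lt : ∀ η ∈ T, a η < κ.ord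
  /-- the sets `A_η` -/
  A : List Ordinal.{u} → Set Ordinal.{u}
  A_subset : ∀ η ∈ T, A η ⊆ Set.Iio (a η)
  /-- `g(β)` is the tuple of the restrictions of the five components to `T ∩ ^{<ω}β` -/
  spec : ∀ β : Below γ.1, (g β).1 =
    zfTuple5 (ZFSet.range fun η : TreeBelow T β.1 => zfList η.seq)
      (zfGraph (fun η : TreeBelow T β.1 => zfList η.seq) fun η => zfSeq fun i : Below β.1 =>
        f η.seq ⟨i.1, lt_trans (Set.mem_Iio.1 i.2) (Set.mem_Iio.1 β.2)⟩)
      (zfGraph (fun η : TreeBelow T β.1 => zfList η.seq) fun η => zfTruth (l η.seq))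
      (zfGraph (fun η : TreeBelow T β.1 => zfList η.seq) fun η => (a η.seq).toZFSet)
      (zfGraph (fun η : TreeBelow T β.1 => zfList η.seq) fun η => zfSub (a η.seq) (A η.seq))

/-- The truth values `t_{F,g}(η)`, by recursion from the maximal nodes down to the root. The
maximum and the minimum range over the `β < γ` with `η⌢⟨β⟩ ∈ T`. -/
def Witness.eval {γ : Below κ.ord} {g : Below γ.1 → HSet κ} (p : Witness γ g)
    (F : Dom κ (Fin 2) → Fin 2) : List Ordinal.{u} → Fin 2 :=
  p.wf.fix fun η t =>
    if (∃ ν, Child p.T ν η) ∧ p.a η ≤ 1 + γ.1 then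
      p.l η (F ⟨γ, p.f η⟩)
        (if ∃ ν, ∃ h : Child p.T ν η, t ν h = 1 then 1 else 0)
        (if ∀ ν, ∀ h : Child p.T ν η, t ν h = 1 then 1 else 0)
    else if γ.1 ∈ p.A η then 1 else 0

/-- `G` is (a version of) the colouring `F^⊗`. For `g` of limit length the value at the root does
not depend on the witness. For `g` of successor length it may, and any choice is allowed. -/
structure IsOtimes (F : Dom κ (Fin 2) → Fin 2) (G : Dom κ (HSet κ) → Fin 2) : Prop where
  zero : ∀ g, lh g = 0 → G g = 0
  nonstandard : ∀ g, 0 < lh g → IsEmpty (Witness g.1 g.2) → G g = 0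
  standard : ∀ g, 0 < lh g → Nonempty (Witness g.1 g.2) →
    ∃ p : Witness g.1 g.2, G g = p.eval F []

theorem exists_isOtimes (F : Dom κ (Fin 2) → Fin 2) : ∃ G, IsOtimes F G := by
  refine ⟨fun g => if h : 0 < lh g ∧ Nonempty (Witness g.1 g.2) then h.2.some.eval F [] else 0,
    ⟨fun g h => ?_, fun g h e => ?_, fun g h e => ⟨e.some, ?_⟩⟩⟩
  · rw [dif_neg]
    rintro ⟨h', -⟩
    exact h'.ne' h
  · rw [dif_neg]
    rintro ⟨-, h'⟩
    exact not_nonempty_iff.2 e h'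
  · rw [dif_pos ⟨h, e⟩]

end

end WeakDiamond

open WeakDiamond

namespace WeakDiamond

noncomputable section

open scoped Classical

variable {κ : Cardinal.{u}} {X : Type v} {F : Dom κ X → Fin 2}

/-! ### Ordinals below an infinite cardinal -/

/-! Write `G` for `F^⊗`. A set lies in `ID1 G` exactly when all its subsets lie in `𝔅⁺(G)`, so `ID1
G` inherits closure under small and diagonal unions from `𝔅⁺(G)`. It contains `ID G`
(`ID_subset_ID1`), hence is saturated as well; normality then bounds antichains of positive sets by
`κ`, and diagonal unions of maximal antichains act as suprema.

Call `A` dense in `D` if every positive `Y ⊆ D` in `𝔅⁺(G)` meets `A` in a positive set. Every `S` in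
`𝔅⁺(G)` splits into two dense halves (`exists_splits_self`). Density gives clause (β) in the
definition of `ID²`, so if `S ∉ ID2 G` then clause (α) fails: some subset of one half is not the
trace of a member of `𝔅⁺(G)`. Cutting that half along this subset yields a positive `D ⊆ S` with
three disjoint dense sets `A 0`, `A 1`, `A 2` (`exists_three_dense_of_notMem_ID2`).

The weak diamond sequence takes the value `i` on `A i`. For each `f` the sets `{δ | Ftr (f ↾ δ) =
i}` belong to `𝔅⁺(G)` (`ColLE.codedPlus_colour`) and cover `D`. If the guesses were correct only on
a nonstationary set, the `i`-th of these sets would meet `A i` negligibly inside `D`, hence by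
density have negligible trace on `D`, for each `i`; then `D` itself would be negligible. -/

theorem add_one_lt_ord (hκ : ℵ₀ ≤ κ) {α : Ordinal.{u}} (h : α < κ.ord) : α + 1 < κ.ord :=
  (isSuccLimit_ord hκ).add_one_lt h

theorem zero_lt_ord (hκ : ℵ₀ ≤ κ) : 0 < κ.ord :=
  (isSuccLimit_ord hκ).bot_lt

theorem one_lt_ord (hκ : ℵ₀ ≤ κ) : 1 < κ.ord := by
  simpa using add_one_lt_ord hκ (zero_lt_ord hκ)

theorem exists_lt_below (hκ : ℵ₀ ≤ κ) (a : Below κ.ord) : ∃ b : Below κ.ord, a < b :=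
  ⟨⟨a.1 + 1, add_one_lt_ord hκ a.2⟩, Subtype.mk_lt_mk.2 (by simp)⟩

/-! ### The nonstationary sets -/

theorem nonstat_mono {S S' : Set (Below κ.ord)} (h : S ∈ nonstat κ) (hS : S' ⊆ S) :
    S' ∈ nonstat κ :=
  fun h' => h (h'.mono hS)

theorem singleton_mem_nonstat (hκ : ℵ₀ ≤ κ) (a : Below κ.ord) : {a} ∈ nonstat κ := by
  refine not_isStationary_iff.2 ⟨Ioi a, ⟨?_, ?_⟩, ?_⟩
  · intro d hd hne _ x hx
    obtain ⟨y, hy⟩ := hne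
    exact lt_of_lt_of_le (hd hy) (hx.1 hy)
  · intro b
    obtain ⟨c, hc⟩ := exists_lt_below hκ (max a b)
    exact ⟨c, (le_max_left a b).trans_lt hc, (le_max_right a b).trans hc.le⟩
  · simp

/-! ### Boolean operations in `𝔅⁺(F)` -/

namespace codedPlus

variable {A B : Set (Below κ.ord)}

theorem empty : codedPlus F ∅ := .null _ not_isStationary_empty

theorem univ : codedPlus F univ := by
  simpa using (empty (F := F)).compl

theorem union (hκ : ℵ₀ ≤ κ) (hA : codedPlus F A) (hB : codedPlus F B) : codedPlus F (A ∪ B) := by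
  have h2 : (1 + 1 : Ordinal.{u}) < κ.ord := add_one_lt_ord hκ (one_lt_ord hκ)
  have := codedPlus.iUnion (F := F) ⟨1 + 1, h2⟩ (fun i => if i.1 = 0 then A else B) (fun i => by
    dsimp only
    split_ifs <;> assumption)
  convert this using 1
  ext x
  simp only [mem_union, mem_iUnion]
  constructor
  · rintro (h | h)
    · exact ⟨⟨0, by simp⟩, by simpa using h⟩
    · exact ⟨⟨1, by simp⟩, by simpa using h⟩
  · rintro ⟨i, hi⟩
    split_ifs at hi
    · exact Or.inl hi
    · exact Or.inr hi

theorem inter (hκ : ℵ₀ ≤ κ) (hA : codedPlus F A) (hB : codedPlus F B) : codedPlus F (A ∩ B) := by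
  simpa [compl_union] using (union hκ hA.compl hB.compl).compl

theorem diff (hκ : ℵ₀ ≤ κ) (hA : codedPlus F A) (hB : codedPlus F B) : codedPlus F (A \ B) :=
  inter hκ hA hB.compl

end codedPlus

/-! ### `ID¹(F)` is a normal `κ`-complete ideal -/

theorem ID1_mono {S S' : Set (Below κ.ord)} (h : S ∈ ID1 F) (hS : S' ⊆ S) : S' ∈ ID1 F := by
  obtain ⟨Z, hZ, hSZ, h⟩ := h
  exact ⟨Z, hZ, hS.trans hSZ, h⟩

theorem codedPlus_of_mem_ID1 {S : Set (Below κ.ord)} (h : S ∈ ID1 F) : codedPlus F S := by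
  obtain ⟨Z, hZ, hSZ, h⟩ := h
  exact h S hSZ

/-- This hereditary form makes the closure properties formal: a subset `Y` of a union, small or
diagonal, is the union of the same kind of the sets `Y ∩ A i`. -/
theorem mem_ID1_iff {S : Set (Below κ.ord)} : S ∈ ID1 F ↔ ∀ Y ⊆ S, codedPlus F Y :=
  ⟨fun h _ hY => codedPlus_of_mem_ID1 (ID1_mono h hY), fun h => ⟨S, h S subset_rfl, subset_rfl, h⟩⟩

theorem ID1_of_nonstat {S : Set (Below κ.ord)} (h : S ∈ nonstat κ) : S ∈ ID1 F :=
  mem_ID1_iff.2 fun _ hY => .null _ (nonstat_mono h hY)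

theorem empty_mem_ID1 : ∅ ∈ ID1 F := ID1_of_nonstat not_isStationary_empty

theorem ID1_iUnion (μ : Below κ.ord) (A : Below μ.1 → Set (Below κ.ord)) (h : ∀ i, A i ∈ ID1 F) :
    (⋃ i, A i) ∈ ID1 F := by
  refine mem_ID1_iff.2 fun Y hY => ?_
  have := codedPlus.iUnion (F := F) μ (fun i => Y ∩ A i)
    fun i => mem_ID1_iff.1 (h i) _ inter_subset_right
  rwa [← inter_iUnion, inter_eq_left.2 hY] at this

theorem ID1_diag (A : Below κ.ord → Set (Below κ.ord)) (h : ∀ i, A i ∈ ID1 F) :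
    diagUnion A ∈ ID1 F := by
  refine mem_ID1_iff.2 fun Y hY => ?_
  have := codedPlus.diag (F := F) (fun i => Y ∩ A i)
    fun i => mem_ID1_iff.1 (h i) _ inter_subset_right
  convert this using 1
  ext x
  constructor
  · intro hx
    obtain ⟨ξ, h1, h2⟩ := hY hx
    exact ⟨ξ, h1, hx, h2⟩
  · rintro ⟨ξ, h1, hx, h2⟩
    exact hx

theorem ID1_union (hκ : ℵ₀ ≤ κ) {A B : Set (Below κ.ord)} (hA : A ∈ ID1 F) (hB : B ∈ ID1 F) :
    A ∪ B ∈ ID1 F := by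
  refine mem_ID1_iff.2 fun Y hY => ?_
  have := codedPlus.union hκ (mem_ID1_iff.1 hA (Y ∩ A) inter_subset_right)
    (mem_ID1_iff.1 hB (Y ∩ B) inter_subset_right)
  rwa [← inter_union_distrib_left, inter_eq_left.2 hY] at this

theorem Iio_mem_ID1 (hκ : ℵ₀ ≤ κ) (a : Below κ.ord) : Iio a ∈ ID1 F := by
  have := ID1_iUnion (F := F) a (fun i => {⟨i.1, lt_trans (mem_Iio.1 i.2) (mem_Iio.1 a.2)⟩})
    fun i => ID1_of_nonstat (singleton_mem_nonstat hκ _)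
  refine ID1_mono this fun x hx => ?_
  simp only [mem_iUnion]
  exact ⟨⟨x.1, hx⟩, rfl⟩

theorem Iic_mem_ID1 (hκ : ℵ₀ ≤ κ) (a : Below κ.ord) : Iic a ∈ ID1 F := by
  obtain ⟨b, hb⟩ := exists_lt_below hκ a
  exact ID1_mono (Iio_mem_ID1 hκ b) fun x hx => lt_of_le_of_lt hx hb

theorem codedPlus_of_diff (hκ : ℵ₀ ≤ κ) {A B : Set (Below κ.ord)} (hA : codedPlus F A)
    (h1 : A \ B ∈ ID1 F) (h2 : B \ A ∈ ID1 F) : codedPlus F B := by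
  have := (hA.diff hκ (codedPlus_of_mem_ID1 h1)).union hκ (codedPlus_of_mem_ID1 h2)
  convert this using 1
  ext x
  simp only [mem_union, mem_sdiff]
  tauto

/-! ### `ID(F)` is contained in `ID¹(F)` -/

theorem ID1_of_idealGen (hκ : ℵ₀ ≤ κ) {𝒜 : Set (Set (Below κ.ord))} (h𝒜 : 𝒜 ⊆ ID1 F)
    {S : Set (Below κ.ord)} (h : idealGen 𝒜 S) : S ∈ ID1 F := by
  induction h with
  | basic S h => exact h𝒜 h
  | singleton a => exact ID1_of_nonstat (singleton_mem_nonstat hκ a)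
  | subset S S' h _ ih => exact ID1_mono ih h
  | iUnion μ A _ ih => exact ID1_iUnion μ A ih
  | diag A _ ih => exact ID1_diag A ih

theorem codedPlus_colour (hκ : ℵ₀ < κ) (f : Below κ.ord → X) :
    codedPlus F {δ | F (restr f δ) = 1} := by
  have hlim := isSuccLimit_ord hκ.le
  have hω : ω < κ.ord := by simpa [lt_ord] using hκ
  have h1 : ∀ α : Below κ.ord, 1 + α.1 < κ.ord := fun α =>
    isPrincipal_add_ord hκ.le (one_lt_ord hκ.le) α.2
  have hc : codedPlus F {α : Below κ.ord | F (restr f ⟨1 + α.1, h1 α⟩) = 1} := by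
    refine .basic _ ⟨f, fun α β h => ?_⟩
    have : β = ⟨1 + α.1, h1 α⟩ := Subtype.ext h
    rw [this]
    rfl
  -- `coded` reads the colour at `1 + α`, which equals `α` from `ω` on; the two sets therefore
  -- differ only below `ω`, and `ω < κ`.
  have key : ∀ α : Below κ.ord, ¬ α < ⟨ω, hω⟩ → (⟨1 + α.1, h1 α⟩ : Below κ.ord) = α := fun α h =>
    Subtype.ext (one_add_of_omega0_le (not_lt.1 h))
  refine codedPlus_of_diff hκ.le hc (ID1_mono (Iio_mem_ID1 hκ.le ⟨ω, hω⟩) ?_)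
    (ID1_mono (Iio_mem_ID1 hκ.le ⟨ω, hω⟩) ?_)
  all_goals
    rintro α ⟨h, h'⟩
    by_contra hα
    simp only [mem_ofPred_eq, key α hα] at h h'
    exact h' h

theorem idMinus_subset_ID1 (hκ : ℵ₀ < κ) {J : Set (Set (Below κ.ord))} (hJ : J ⊆ ID1 F) :
    idMinus F J ⊆ ID1 F := by
  intro S hS
  refine mem_ID1_iff.2 fun S' hS' => ?_
  obtain ⟨f, hf⟩ := hS S' hS'
  have hE := codedPlus_of_mem_ID1 (hJ hf)
  have hC := codedPlus_colour (F := F) hκ f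
  -- `S'` is the symmetric difference of the error set of `f`, which lies in `J`, and the set of
  -- points of colour 1.
  have hEC := (hE.diff hκ.le hC).union hκ.le (hC.diff hκ.le hE)
  convert hEC using 1
  ext δ
  have : F (restr f δ) = 0 ↔ ¬ F (restr f δ) = 1 := by
    generalize F (restr f δ) = x
    revert x
    decide
  simp only [mem_union, mem_sdiff, mem_ofPred_eq, this]
  tauto

theorem ID_subset_ID1 (hκ : ℵ₀ < κ) : ID F ⊆ ID1 F := by
  refine iUnion_subset fun α => ?_
  induction α using Ordinal.limitRecOn with
  | zero =>
    rw [idLevel, limitRecOn_zero]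
    exact fun S hS => ID1_of_nonstat hS
  | add_one α ih =>
    rw [idLevel, limitRecOn_add_one]
    exact fun S hS => ID1_of_idealGen hκ.le (idMinus_subset_ID1 hκ ih) hS
  | limit α hα ih =>
    rw [idLevel, limitRecOn_limit _ _ _ _ hα]
    exact fun S hS => ID1_of_idealGen hκ.le (𝒜 := ⋃ β : Below α, idLevel F β.1)
      (iUnion_subset fun β => ih β.1 β.2) hS

theorem IsSaturated.mono {J J' : Set (Set (Below κ.ord))} (h : IsSaturated J) (hJ : J ⊆ J') :
    IsSaturated J' := by
  rintro ⟨A, hA, hA'⟩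
  exact h ⟨A, fun α hα => hA α (hJ hα), hA'⟩

/-! ### Maximal antichains modulo `ID¹(F)` -/

theorem mk_Iic_below_lt (hκ : ℵ₀ ≤ κ) (a : Below κ.ord) :
    #(Iic a : Set (Below κ.ord)) < Cardinal.lift.{u + 1} κ := by
  have h : #(Iic a : Set (Below κ.ord)) ≤ #(Iio (a.1 + 1)) :=
    mk_le_of_injective (f := fun x => ⟨x.1.1, mem_Iio.2 (Order.lt_add_one_iff.2 x.2)⟩) fun x y hxy => by
      simp only [Subtype.mk.injEq] at hxy
      exact Subtype.ext (Subtype.ext hxy)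
  refine h.trans_lt ?_
  rw [Cardinal.mk_Iio_ordinal, Cardinal.lift_lt]
  exact lt_ord.1 (add_one_lt_ord hκ a.2)

/-- Saturation speaks of intersections of size `< κ`, an antichain only of intersections in `ID1 F`.
Given `κ⁺` members, inject each `α < κ⁺` into `κ` by `e α` and remove from the `α`-th set the
diagonal union `N α` of its intersections with the earlier ones. What is left of the `α`-th and
`β`-th sets for `β < α` meets only at points `δ ≤ e α β`. -/
theorem mk_antichain_le (hκ : ℵ₀ ≤ κ) (hsat : IsSaturated (ID1 F))
    {M : Set (Set (Below κ.ord))} (hM : ∀ A ∈ M, A ∉ ID1 F)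
    (hM' : M.Pairwise fun A B => A ∩ B ∈ ID1 F) : #M ≤ #(Below κ.ord) := by
  by_contra hlt
  rw [not_le, Cardinal.mk_Iio_ordinal, card_ord] at hlt
  have hle : #(Below (Order.succ κ).ord) ≤ #M := by
    rw [Cardinal.mk_Iio_ordinal, card_ord, Cardinal.lift_succ]
    exact Order.succ_le_of_lt hlt
  obtain ⟨φ⟩ := hle
  have he : ∀ α : Below (Order.succ κ).ord, Nonempty (Below α.1 ↪ Below κ.ord) := fun α => by
    refine (Cardinal.le_def _ _).1 ?_
    rw [Cardinal.mk_Iio_ordinal, Cardinal.mk_Iio_ordinal, card_ord, Cardinal.lift_le]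
    exact Order.lt_succ_iff.1 (lt_ord.1 α.2)
  let e := fun α => (he α).some
  let N : Below (Order.succ κ).ord → Set (Below κ.ord) := fun α => diagUnion fun ξ =>
    {δ | δ ∈ (φ α).1 ∧ ∃ β : Below (Order.succ κ).ord, ∃ h : β.1 < α.1,
      e α ⟨β.1, h⟩ = ξ ∧ δ ∈ (φ β).1}
  have hN : ∀ α, N α ∈ ID1 F := fun α => by
    refine ID1_diag _ fun ξ => ?_
    by_cases hξ : ∃ β : Below (Order.succ κ).ord, ∃ h : β.1 < α.1, e α ⟨β.1, h⟩ = ξ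
    · obtain ⟨β, h, hβ⟩ := hξ
      have hne : (φ α).1 ≠ (φ β).1 := fun h' =>
        h.ne' (congrArg Subtype.val (φ.injective (Subtype.ext h')))
      refine ID1_mono (hM' (φ α).2 (φ β).2 hne) ?_
      rintro δ ⟨h1, β', h', hβ', h2⟩
      have hββ' : β'.1 = β.1 := congrArg (fun x : Below α.1 => x.1)
        ((e α).injective (hβ'.trans hβ.symm))
      obtain rfl : β' = β := Subtype.ext hββ'
      exact ⟨h1, h2⟩
    · convert empty_mem_ID1
      refine eq_empty_of_forall_notMem ?_
      rintro δ ⟨-, β, h, hβ, -⟩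
      exact hξ ⟨β, h, hβ⟩
  refine hsat ⟨fun α => (φ α).1 \ N α, fun α hα => hM _ (φ α).2 ?_, fun β α hβα => ?_⟩
  · refine ID1_mono (ID1_union hκ hα (hN α)) fun x hx => ?_
    by_cases h : x ∈ N α
    · exact Or.inr h
    · exact Or.inl ⟨hx, h⟩
  · refine (mk_le_mk_of_subset ?_).trans_lt (mk_Iic_below_lt hκ (e α ⟨β.1, hβα⟩))
    rintro δ ⟨⟨h1, -⟩, h2, h3⟩
    by_contra h4
    exact h3 ⟨_, not_le.1 h4, h2, β, hβα, rfl, h1⟩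

/-- `D` enumerates a maximal antichain of positive members of `𝒟`, with repetitions; the second
clause is its maximality. The hypothesis `∅ ∈ 𝒟` provides a constant sequence when the antichain is
empty. -/
theorem exists_antichain_seq (hκ : ℵ₀ ≤ κ) (hsat : IsSaturated (ID1 F))
    (𝒟 : Set (Set (Below κ.ord))) (h0 : ∅ ∈ 𝒟) :
    ∃ D : Below κ.ord → Set (Below κ.ord), (∀ ξ, D ξ ∈ 𝒟) ∧
      ∀ E ∈ 𝒟, (∀ ξ, E ∩ D ξ ∈ ID1 F) → E ∈ ID1 F := by
  obtain ⟨M, hM⟩ := zorn_subset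
    {M : Set (Set (Below κ.ord)) | M ⊆ 𝒟 \ ID1 F ∧ M.Pairwise fun A B => A ∩ B ∈ ID1 F}
    (fun c hc hchain => ⟨⋃₀ c, ⟨sUnion_subset fun M hM => (hc hM).1,
      (pairwise_sUnion hchain.directedOn).2 fun M hM => (hc hM).2⟩,
      fun M hM => subset_sUnion_of_mem hM⟩)
  have hle := mk_antichain_le hκ hsat (fun A hA => (hM.prop.1 hA).2) hM.prop.2
  have hmax : ∀ E ∈ 𝒟, (∀ A ∈ M, E ∩ A ∈ ID1 F) → E ∈ ID1 F := fun E hE h => by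
    by_contra hE'
    have hins : insert E M ⊆ M := hM.le_of_ge
      ⟨insert_subset ⟨hE, hE'⟩ hM.prop.1, hM.prop.2.insert fun A hA _ =>
        ⟨h A hA, by rw [inter_comm]; exact h A hA⟩⟩ (subset_insert E M)
    exact hE' (by simpa using h E (hins (mem_insert E M)))
  rcases M.eq_empty_or_nonempty with rfl | hne
  · exact ⟨fun _ => ∅, fun _ => h0, fun E hE _ => hmax E hE (by simp)⟩
  · have : Nonempty M := hne.to_subtype
    obtain ⟨φ⟩ := (Cardinal.le_def _ _).1 hle
    have hs := Function.invFun_surjective φ.injective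
    refine ⟨fun ξ => (Function.invFun φ ξ).1, fun ξ => (hM.prop.1 (Function.invFun φ ξ).2).1,
      fun E hE h => hmax E hE fun A hA => ?_⟩
    obtain ⟨ξ, hξ⟩ := hs ⟨A, hA⟩
    simpa [hξ] using h ξ

/-! ### Dense sets -/

/-- `A` meets every `ID¹(F)`-positive member of `𝔅⁺(F)` contained in `D` in a positive set. -/
def DenseIn (F : Dom κ X → Fin 2) (A D : Set (Below κ.ord)) : Prop :=
  ∀ Y ⊆ D, codedPlus F Y → Y ∩ A ∈ ID1 F → Y ∈ ID1 F

theorem DenseIn.mono {A A' D D' : Set (Below κ.ord)} (h : DenseIn F A D) (hD : D' ⊆ D)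
    (hA : D' ∩ A ⊆ A') : DenseIn F A' D' :=
  fun Y hY hYB hYA => h Y (hY.trans hD) hYB
    (ID1_mono hYA fun _ hx => ⟨hx.1, hA ⟨hY hx.1, hx.2⟩⟩)

/-- There is a largest member of `𝔅⁺(F)` almost disjoint from `A`. -/
theorem exists_codedPlus_denseIn_compl (hκ : ℵ₀ ≤ κ) (hsat : IsSaturated (ID1 F))
    (A : Set (Below κ.ord)) :
    ∃ W, codedPlus F W ∧ W ∩ A ∈ ID1 F ∧ DenseIn F A Wᶜ := by
  obtain ⟨D, hD, hmax⟩ := exists_antichain_seq hκ hsat {D | codedPlus F D ∧ D ∩ A ∈ ID1 F}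
    ⟨.empty, by simpa using empty_mem_ID1⟩
  -- A set disjoint from `diagUnion D` meets `D ξ` only in points `≤ ξ`, hence is almost disjoint
  -- from every `D ξ`, and maximality applies.
  refine ⟨diagUnion D, .diag _ fun ξ => (hD ξ).1, ?_, fun Y hY hYB hYA => ?_⟩
  · refine ID1_mono (ID1_diag _ fun ξ => (hD ξ).2) ?_
    rintro x ⟨⟨ξ, h1, h2⟩, h3⟩
    exact ⟨ξ, h1, h2, h3⟩
  · refine hmax Y ⟨hYB, hYA⟩ fun ξ => ID1_mono (Iic_mem_ID1 hκ ξ) ?_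
    rintro x ⟨h1, h2⟩
    by_contra h3
    exact hY h1 ⟨ξ, not_le.1 h3, h2⟩

/-- The set `D` splits into the two dense subsets `D ∩ A` and `D \ A`. -/
def Splits (F : Dom κ X → Fin 2) (D A : Set (Below κ.ord)) : Prop :=
  DenseIn F A D ∧ DenseIn F Aᶜ D

/-- Take `A ⊆ C` outside `𝔅⁺(F)` and remove from `C` the largest members `W₁`, `W₂` of `𝔅⁺(F)`
almost disjoint from `A` and from `C \ A`. Were the rest negligible, `A` would agree with `C ∩ W₂`
modulo `ID1 F` and so lie in `𝔅⁺(F)`. -/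
theorem exists_splits (hκ : ℵ₀ ≤ κ) (hsat : IsSaturated (ID1 F)) {C : Set (Below κ.ord)}
    (hC : codedPlus F C) (hC' : C ∉ ID1 F) :
    ∃ D ⊆ C, codedPlus F D ∧ D ∉ ID1 F ∧ ∃ A, Splits F D A := by
  rw [mem_ID1_iff] at hC'
  push Not at hC'
  obtain ⟨A, hAC, hA⟩ := hC'
  obtain ⟨W₁, hW₁, hW₁A, hd₁⟩ := exists_codedPlus_denseIn_compl hκ hsat A
  obtain ⟨W₂, hW₂, hW₂A, hd₂⟩ := exists_codedPlus_denseIn_compl hκ hsat (C \ A)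
  refine ⟨(C \ W₁) \ W₂, fun x hx => hx.1.1, (hC.diff hκ hW₁).diff hκ hW₂, fun hD => hA ?_, A,
    hd₁.mono (fun x hx => hx.1.2) inter_subset_right, hd₂.mono (fun x hx => hx.2)
      fun x hx => hx.2.2⟩
  refine codedPlus_of_diff hκ (hC.inter hκ hW₂)
    (ID1_mono hW₂A fun x hx => ⟨hx.1.2, hx.1.1, hx.2⟩)
    (ID1_mono (ID1_union hκ hW₁A hD) ?_)
  rintro x ⟨h1, h2⟩
  by_cases h3 : x ∈ W₁
  · exact Or.inl ⟨h3, h1⟩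
  · exact Or.inr ⟨⟨hAC h1, h3⟩, fun h4 => h2 ⟨hAC h1, h4⟩⟩

/-- A set meeting each `D ξ` minus the earlier ones in a dense set is dense in any set that is
almost covered by the diagonal union of the `D ξ`. -/
theorem denseIn_of_diagUnion (hκ : ℵ₀ ≤ κ) {S A : Set (Below κ.ord)}
    {D B : Below κ.ord → Set (Below κ.ord)} (hD : ∀ ξ, codedPlus F (D ξ))
    (hB : ∀ ξ, DenseIn F (B ξ) (D ξ)) (hS : S \ diagUnion D ∈ ID1 F)
    (hA : ∀ ξ δ, δ ∈ D ξ → (∀ ζ < ξ, δ ∉ D ζ) → δ ∈ B ξ → δ ∈ A) : DenseIn F A S := by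
  intro Y hY hYB hYA
  have key : ∀ ξ, Y ∩ D ξ ∈ ID1 F := by
    intro ξ
    induction ξ using WellFoundedLT.induction with
    | ind ξ ih =>
    -- The `D ξ` may overlap, and `B ξ` controls `A` only where `ξ` is the least index; the overlap
    -- `E` with earlier indices is negligible by induction.
    let E : Set (Below κ.ord) := ⋃ i : Below ξ.1, Y ∩ D ⟨i.1, lt_trans (mem_Iio.1 i.2) (mem_Iio.1 ξ.2)⟩
    have hE : E ∈ ID1 F := ID1_iUnion ξ _ fun i => ih _ i.2
    have hpos : (Y ∩ D ξ) \ E ∈ ID1 F := by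
      refine hB ξ _ (fun x hx => hx.1.2) ((hYB.inter hκ (hD ξ)).diff hκ (codedPlus_of_mem_ID1 hE))
        (ID1_mono hYA ?_)
      rintro x ⟨⟨⟨h1, h2⟩, h3⟩, h4⟩
      refine ⟨h1, hA ξ x h2 (fun ζ hζ h5 => h3 ?_) h4⟩
      exact mem_iUnion.2 ⟨⟨ζ.1, hζ⟩, h1, h5⟩
    exact ID1_mono (ID1_union hκ hpos hE) (by simp)
  refine ID1_mono (ID1_union hκ (ID1_diag _ key) hS) fun x hx => ?_
  by_cases h : x ∈ diagUnion D
  · obtain ⟨ξ, h1, h2⟩ := h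
    exact Or.inl ⟨ξ, h1, hx, h2⟩
  · exact Or.inr ⟨hY hx, h⟩

theorem exists_splits_self (hκ : ℵ₀ ≤ κ) (hsat : IsSaturated (ID1 F)) {S : Set (Below κ.ord)}
    (hS : codedPlus F S) : ∃ A, Splits F S A := by
  obtain ⟨D, hD, hmax⟩ := exists_antichain_seq hκ hsat
    {D | codedPlus F D ∧ ∃ A, Splits F D A}
    ⟨.empty, ∅, fun Y hY _ _ => ID1_mono empty_mem_ID1 hY, fun Y hY _ _ => ID1_mono empty_mem_ID1 hY⟩
  choose hDB B hB using hD
  -- A positive remainder would contain a positive splittable set almost disjoint from every `D ξ`,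
  -- against maximality.
  have hcov : S \ diagUnion D ∈ ID1 F := by
    by_contra hpos
    obtain ⟨E, hE, hEB, hE', A, hA⟩ := exists_splits hκ hsat (hS.diff hκ (.diag _ hDB)) hpos
    refine hE' (hmax E ⟨hEB, A, hA⟩ fun ξ => ID1_mono (Iic_mem_ID1 hκ ξ) ?_)
    rintro x ⟨h1, h2⟩
    by_contra h3
    exact (hE h1).2 ⟨ξ, not_le.1 h3, h2⟩
  -- The local splittings are pasted by letting the least `ξ` with `δ ∈ D ξ` decide.
  refine ⟨{δ | ∃ ξ, δ ∈ D ξ ∧ (∀ ζ < ξ, δ ∉ D ζ) ∧ δ ∈ B ξ},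
    denseIn_of_diagUnion hκ hDB (fun ξ => (hB ξ).1) hcov fun ξ δ h1 h2 h3 => ⟨ξ, h1, h2, h3⟩,
    denseIn_of_diagUnion hκ hDB (fun ξ => (hB ξ).2) hcov fun ξ δ h1 h2 h3 => ?_⟩
  rintro ⟨ξ', h1', h2', h3'⟩
  rcases lt_trichotomy ξ ξ' with h | rfl | h
  · exact h2' ξ h h1
  · exact h3 h3'
  · exact h2 ξ' h h1'

/-! ### Splitting into three dense sets -/

/-- If `A` is dense in `S` but some subset of `S \ A` is not the trace of a member of `𝔅⁺(F)`, then
some positive set splits into three dense sets. -/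
theorem exists_three_dense (hκ : ℵ₀ ≤ κ) (hsat : IsSaturated (ID1 F)) {S A Z : Set (Below κ.ord)}
    (hS : codedPlus F S) (hA : DenseIn F A S) (hZ : Z ⊆ S \ A)
    (hZ' : ¬ ∃ Y, codedPlus F Y ∧ Z = Y ∩ (S \ A)) :
    ∃ D ⊆ S, codedPlus F D ∧ D ∉ ID1 F ∧ DenseIn F A D ∧ DenseIn F Z D ∧
      DenseIn F ((S \ A) \ Z) D := by
  obtain ⟨W₁, hW₁, hW₁Z, hd₁⟩ := exists_codedPlus_denseIn_compl hκ hsat Z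
  obtain ⟨W₂, hW₂, hW₂Z, hd₂⟩ := exists_codedPlus_denseIn_compl hκ hsat ((S \ A) \ Z)
  refine ⟨(S \ W₁) \ W₂, fun x hx => hx.1.1, (hS.diff hκ hW₁).diff hκ hW₂, fun hD => hZ' ?_,
    hA.mono (fun x hx => hx.1.1) inter_subset_right,
    hd₁.mono (fun x hx => hx.1.2) inter_subset_right, hd₂.mono (fun x hx => hx.2)
      inter_subset_right⟩
  -- If `D` were negligible, `W₂` would almost contain `Z` and almost miss the rest of `S \ A`;
  -- correcting `W₂` on two sets in `ID1 F` makes its trace on `S \ A` exactly `Z`.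
  have hN : Z \ W₂ ∈ ID1 F := by
    refine ID1_mono (ID1_union hκ hW₁Z hD) fun x hx => ?_
    by_cases h : x ∈ W₁
    · exact Or.inl ⟨h, hx.1⟩
    · exact Or.inr ⟨⟨(hZ hx.1).1, h⟩, hx.2⟩
  refine ⟨(W₂ \ (W₂ ∩ ((S \ A) \ Z))) ∪ (Z \ W₂),
    (hW₂.diff hκ (codedPlus_of_mem_ID1 hW₂Z)).union hκ (codedPlus_of_mem_ID1 hN), ?_⟩
  ext x
  have := @hZ x
  simp only [mem_inter_iff, mem_union, mem_sdiff] at this ⊢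
  tauto

theorem exists_three_dense_of_notMem_ID2 (hκ : ℵ₀ ≤ κ) (hsat : IsSaturated (ID1 F))
    {S : Set (Below κ.ord)} (hS : codedPlus F S) (hS' : S ∉ ID2 F) :
    ∃ D ⊆ S, codedPlus F D ∧ D ∉ ID1 F ∧ ∃ A : Fin 3 → Set (Below κ.ord),
      Pairwise (fun i j => Disjoint (A i) (A j)) ∧ ∀ i, DenseIn F (A i) D := by
  obtain ⟨A, hA⟩ := exists_splits_self hκ hsat hS
  have hsplit : ∀ A Z : Set (Below κ.ord), DenseIn F A S → Z ⊆ S \ A →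
      (¬ ∃ Y, codedPlus F Y ∧ Z = Y ∩ (S \ A)) →
      ∃ D ⊆ S, codedPlus F D ∧ D ∉ ID1 F ∧ ∃ A : Fin 3 → Set (Below κ.ord),
        Pairwise (fun i j => Disjoint (A i) (A j)) ∧ ∀ i, DenseIn F (A i) D := by
    intro A Z h1 h2 h3
    obtain ⟨D, hDS, hD, hD', hd1, hd2, hd3⟩ := exists_three_dense hκ hsat hS h1 h2 h3
    have d1 : Disjoint A Z := disjoint_left.2 fun x hx hx' => (h2 hx').2 hx
    have d2 : Disjoint A ((S \ A) \ Z) := disjoint_left.2 fun x hx hx' => hx'.1.2 hx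
    have d3 : Disjoint Z ((S \ A) \ Z) := disjoint_left.2 fun x hx hx' => hx'.2 hx
    refine ⟨D, hDS, hD, hD', ![A, Z, (S \ A) \ Z], fun i j hij => ?_, fun i => ?_⟩
    · fin_cases i <;> fin_cases j <;> simp_all [disjoint_comm]
    · fin_cases i <;> assumption
  by_contra hno
  have htrace : ∀ A : Set (Below κ.ord), DenseIn F A S →
      {W | W ⊆ S \ A} = {W | ∃ Y, codedPlus F Y ∧ W = Y ∩ (S \ A)} := by
    intro A hA
    ext Z
    constructor
    · intro hZ
      by_contra hZ'
      exact hno (hsplit A Z hA hZ hZ')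
    · rintro ⟨Y, -, rfl⟩
      exact inter_subset_right
  -- This is clause (β) of `ID²`: removing `S \ A` from `Y` leaves at least `Y ∩ S ∩ A`, which is
  -- negligible only if `Y ∩ S` is. It is used, like `htrace`, for both `A` and its complement.
  have hsmall : ∀ A : Set (Below κ.ord), DenseIn F A S → ∀ Y, codedPlus F Y →
      Y \ (S \ A) ∈ ID1 F → Y ∈ ID1 F := by
    intro A hA Y hY hYS
    have h1 : Y ∩ S ∈ ID1 F := hA _ inter_subset_right (hY.inter hκ hS)
      (ID1_mono hYS fun x hx => ⟨hx.1.1, fun h => h.2 hx.2⟩)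
    refine ID1_mono (ID1_union hκ h1 hYS) fun x hx => ?_
    by_cases h : x ∈ S
    · exact Or.inl ⟨hx, h⟩
    · exact Or.inr ⟨hx, fun h' => h h'.1⟩
  refine hS' ⟨S, hS, subset_rfl, ![S \ A, S \ Aᶜ], ?_, ?_, fun l => ?_, ?_⟩
  · ext x
    simp only [Matrix.cons_val_zero, Matrix.cons_val_one, mem_union, mem_sdiff, mem_compl_iff]
    tauto
  · refine disjoint_left.2 fun x hx hx' => ?_
    exact hx'.2 hx.2
  · fin_cases l
    · exact htrace _ hA.1
    · exact htrace _ hA.2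
  · rintro ⟨Y, hY, l, h1, h2⟩
    fin_cases l
    · exact h2 (hsmall _ hA.1 Y hY h1)
    · exact h2 (hsmall _ hA.2 Y hY h1)

/-! ### Closure points -/

/-- Proper initial segments lie in `ID1 F`, so one diagonal union shows that almost every `δ` is
closed under `φ`; this replaces an argument with clubs. -/
theorem not_closed_mem_ID1 (hκ : ℵ₀ ≤ κ) (φ : Below κ.ord → Below κ.ord) :
    {δ | ∃ α < δ, δ ≤ φ α} ∈ ID1 F :=
  ID1_diag (fun α => Iic (φ α)) fun α => Iic_mem_ID1 hκ (φ α)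

theorem not_isSuccLimit_mem_ID1 (hκ : ℵ₀ ≤ κ) :
    {δ : Below κ.ord | ¬ Order.IsSuccLimit δ.1} ∈ ID1 F := by
  choose φ hφ using fun α : Below κ.ord => exists_lt_below hκ α
  refine ID1_mono (ID1_union hκ (not_closed_mem_ID1 hκ φ) (Iic_mem_ID1 hκ ⟨0, zero_lt_ord hκ⟩)) ?_
  intro δ hδ
  rcases zero_or_succ_or_isSuccLimit δ.1 with h | ⟨α, h⟩ | h
  · exact Or.inr (mem_Iic.2 (Subtype.coe_le_coe.1 h.le))
  · have hα : α < δ.1 := h ▸ Order.lt_succ α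
    refine Or.inl ⟨⟨α, hα.trans δ.2⟩, hα, ?_⟩
    refine Subtype.coe_le_coe.1 (h.symm.le.trans (Order.succ_le_of_lt ?_))
    exact Subtype.coe_lt_coe.2 (hφ ⟨α, hα.trans δ.2⟩)
  · exact absurd h hδ

/-! ### Hereditarily small sets -/

/-- This and the following closure facts serve to place the terms of `twoTreeSeq` in `ℋ(κ)`. -/
theorem hereditarily_range {ι : Type w} [Small.{u} ι] {f : ι → ZFSet.{u}}
    (hι : Cardinal.lift.{u} #ι < Cardinal.lift.{w} κ)
    (h : ∀ i, (f i).Hereditarily fun y => y.card < κ) :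
    (ZFSet.range f).Hereditarily fun y => y.card < κ := by
  refine ZFSet.hereditarily_iff.2 ⟨?_, fun y hy => ?_⟩
  · rw [← Cardinal.lift_lt.{u, w}]
    exact ZFSet.lift_card_range_le.trans_lt hι
  · obtain ⟨i, rfl⟩ := ZFSet.mem_range.1 hy
    exact h i

theorem hereditarily_range_of_finite (hκ : ℵ₀ ≤ κ) {ι : Type w} [Finite ι] [Small.{u} ι]
    {f : ι → ZFSet.{u}} (h : ∀ i, (f i).Hereditarily fun y => y.card < κ) :
    (ZFSet.range f).Hereditarily fun y => y.card < κ := by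
  refine hereditarily_range ?_ h
  refine lt_of_lt_of_le (b := ℵ₀) ?_ (by simpa using hκ)
  simp

theorem hereditarily_pair (hκ : ℵ₀ ≤ κ) {x y : ZFSet.{u}}
    (hx : x.Hereditarily fun y => y.card < κ) (hy : y.Hereditarily fun y => y.card < κ) :
    (ZFSet.pair x y).Hereditarily fun y => y.card < κ := by
  have h1 : ∀ z : ZFSet.{u}, ({z} : ZFSet.{u}).card < κ := fun z => by
    rw [ZFSet.card_singleton]
    exact one_lt_aleph0.trans_le hκ
  have h2 : ∀ z w : ZFSet.{u}, ({z, w} : ZFSet.{u}).card < κ := fun z w => by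
    refine ZFSet.card_insert_le.trans_lt ?_
    rw [ZFSet.card_singleton]
    exact (add_lt_aleph0 one_lt_aleph0 one_lt_aleph0).trans_le hκ
  refine ZFSet.hereditarily_iff.2 ⟨h2 _ _, fun z hz => ?_⟩
  rcases ZFSet.mem_pair.1 hz with rfl | rfl
  · refine ZFSet.hereditarily_iff.2 ⟨h1 _, fun w hw => ?_⟩
    rwa [ZFSet.mem_singleton.1 hw]
  · refine ZFSet.hereditarily_iff.2 ⟨h2 _ _, fun w hw => ?_⟩
    rcases ZFSet.mem_pair.1 hw with rfl | rfl <;> assumption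

theorem hereditarily_toZFSet {α : Ordinal.{u}} (hα : α < κ.ord) :
    α.toZFSet.Hereditarily fun y => y.card < κ := by
  induction α using WellFoundedLT.induction with
  | ind α ih =>
  refine ZFSet.hereditarily_iff.2 ⟨?_, fun y hy => ?_⟩
  · rw [card_toZFSet]
    exact lt_ord.1 hα
  · obtain ⟨β, hβ, rfl⟩ := mem_toZFSet_iff.1 hy
    exact ih β hβ (hβ.trans hα)

theorem hereditarily_zfNat (hκ : ℵ₀ ≤ κ) (n : ℕ) :
    (zfNat.{u} n).Hereditarily fun y => y.card < κ :=
  hereditarily_toZFSet (lt_ord.2 (by simpa using natCast_lt_aleph0.trans_le hκ))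

theorem hereditarily_zfGraph_of_finite (hκ : ℵ₀ ≤ κ) {ι : Type w} [Finite ι] [Small.{u} ι]
    {a b : ι → ZFSet.{u}} (ha : ∀ i, (a i).Hereditarily fun y => y.card < κ)
    (hb : ∀ i, (b i).Hereditarily fun y => y.card < κ) :
    (zfGraph a b).Hereditarily fun y => y.card < κ :=
  hereditarily_range_of_finite hκ fun i => hereditarily_pair hκ (ha i) (hb i)

theorem hereditarily_zfList (hκ : ℵ₀ ≤ κ) {η : List Ordinal.{u}} (hη : ∀ x ∈ η, x < κ.ord) :
    (zfList η).Hereditarily fun y => y.card < κ :=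
  hereditarily_zfGraph_of_finite hκ (fun _ => hereditarily_zfNat hκ _)
    fun i => hereditarily_toZFSet (hη _ (List.get_mem η i))

theorem lift_mk_below_lt {β : Ordinal.{u}} (hβ : β < κ.ord) :
    Cardinal.lift.{u} #(Below β) < Cardinal.lift.{u + 1} κ := by
  rw [Cardinal.mk_Iio_ordinal, Cardinal.lift_lift, Cardinal.lift_lt]
  exact lt_ord.1 hβ

theorem hereditarily_zfSeq (hκ : ℵ₀ ≤ κ) {β : Ordinal.{u}} (hβ : β < κ.ord)
    (s : Below β → Fin 2) : (zfSeq s).Hereditarily fun y => y.card < κ :=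
  hereditarily_range (lift_mk_below_lt hβ) fun i => hereditarily_pair hκ
    (hereditarily_toZFSet ((mem_Iio.1 i.2).trans hβ)) (hereditarily_zfNat hκ _)

theorem hereditarily_zfTruth (hκ : ℵ₀ ≤ κ) (l : Fin 2 → Fin 2 → Fin 2 → Fin 2) :
    (zfTruth.{u} l).Hereditarily fun y => y.card < κ :=
  hereditarily_zfGraph_of_finite hκ (fun _ => hereditarily_zfGraph_of_finite hκ
    (fun _ => hereditarily_zfNat hκ _) fun _ => hereditarily_zfNat hκ _)
    fun _ => hereditarily_zfNat hκ _

theorem hereditarily_zfSub {α : Ordinal.{u}} (hα : α < κ.ord) (A : Set Ordinal.{u}) :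
    (zfSub α A).Hereditarily fun y => y.card < κ :=
  hereditarily_range (lt_of_le_of_lt (Cardinal.lift_le.2 (mk_subtype_le _)) (lift_mk_below_lt hα))
    fun x => hereditarily_toZFSet ((mem_Iio.1 x.1.2).trans hα)

/-! ### Injectivity of the coding -/

theorem zfGraph_eq {ι : Type v} {ι' : Type w} [Small.{u} ι] [Small.{u} ι'] {a b : ι → ZFSet.{u}}
    {a' b' : ι' → ZFSet.{u}} (h : zfGraph a b = zfGraph a' b') (i : ι) :
    ∃ j, a' j = a i ∧ b' j = b i := by
  have hi : ZFSet.pair (a i) (b i) ∈ zfGraph a' b' := h ▸ ZFSet.mem_range_self i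
  obtain ⟨j, hj⟩ := ZFSet.mem_range.1 hi
  exact ⟨j, ZFSet.pair_inj.1 hj⟩

theorem zfNat_injective : Function.Injective zfNat.{u} := fun m n h => by
  simpa using toZFSet_injective h

theorem zfList_injective : Function.Injective zfList.{u} := by
  have key : ∀ {η ζ : List Ordinal.{u}}, zfList η = zfList ζ → ∀ (i : ℕ) (hi : i < η.length),
      ∃ hj : i < ζ.length, ζ[i] = η[i] := by
    intro η ζ h i hi
    obtain ⟨j, h1, h2⟩ := zfGraph_eq h ⟨i, hi⟩
    obtain rfl := zfNat_injective h1
    exact ⟨j.2, toZFSet_injective h2⟩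
  intro η ζ h
  refine List.ext_getElem (le_antisymm ?_ ?_) fun i hi _ => (key h i hi).2.symm
  · exact le_of_forall_lt fun i hi => (key h i hi).1
  · exact le_of_forall_lt fun i hi => (key h.symm i hi).1

theorem zfSeq_injective {β : Ordinal.{u}} : Function.Injective (zfSeq (β := β)) := by
  intro s t h
  funext i
  obtain ⟨j, h1, h2⟩ := zfGraph_eq h i
  obtain rfl : j = i := Subtype.ext (toZFSet_injective h1)
  exact (Fin.ext (zfNat_injective h2)).symm

theorem zfTruth_injective : Function.Injective zfTruth.{u} := by
  intro l l' h
  funext x y z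
  obtain ⟨⟨x', y', z'⟩, h1, h2⟩ := zfGraph_eq h (x, y, z)
  have key : ∀ i : Fin 3, (![x', y', z'] i : ℕ) = ![x, y, z] i := by
    intro i
    obtain ⟨j, h3, h4⟩ := zfGraph_eq h1.symm i
    obtain rfl : j = i := Fin.ext (zfNat_injective h3)
    exact zfNat_injective h4
  obtain rfl : x' = x := Fin.ext (key 0)
  obtain rfl : y' = y := Fin.ext (key 1)
  obtain rfl : z' = z := Fin.ext (key 2)
  exact (Fin.ext (zfNat_injective h2)).symm

theorem zfTuple5_inj {a b c d e a' b' c' d' e' : ZFSet.{u}} :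
    zfTuple5 a b c d e = zfTuple5 a' b' c' d' e' ↔ a = a' ∧ b = b' ∧ c = c' ∧ d = d' ∧ e = e' := by
  simp [zfTuple5, ZFSet.pair_inj]

/-! ### Independence of the witness at limits -/

theorem TreeBelow.exists_seq_eq {T : Set (List Ordinal.{u})} {β : Ordinal.{u}}
    {η : List Ordinal.{u}} (hη : η ∈ T) (h : ∀ x ∈ η, x < β) : ∃ ζ : TreeBelow T β, ζ.seq = η := by
  have h' : (η.pmap (fun x hx => (⟨x, mem_Iio.2 hx⟩ : Below β)) h).map Subtype.val = η := by
    simp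
  exact ⟨⟨_, h'.symm ▸ hη⟩, h'⟩

theorem exists_forall_mem_lt {γ : Ordinal.{u}} (hγ : Order.IsSuccLimit γ) {η : List Ordinal.{u}}
    (h : ∀ x ∈ η, x < γ) : ∃ β < γ, ∀ x ∈ η, x < β := by
  induction η with
  | nil => exact ⟨0, hγ.bot_lt, by simp⟩
  | cons y η ih =>
    obtain ⟨β, hβ, hη⟩ := ih fun x hx => h x (List.mem_cons_of_mem y hx)
    refine ⟨max (y + 1) β, max_lt (hγ.add_one_lt (h y List.mem_cons_self)) hβ, fun x hx => ?_⟩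
    rcases List.mem_cons.1 hx with rfl | hx
    · exact lt_max_of_lt_left (Order.lt_add_one_iff.2 le_rfl)
    · exact lt_max_of_lt_right (hη x hx)

namespace Witness

variable {γ : Below κ.ord} {g : Below γ.1 → HSet κ}

/-- The coding is injective, so `g β` determines the data on nodes with entries below `β`. The
component `A` is left out: the evaluation used later, `eval_eq`, never reads it. -/
theorem eq_at (p q : Witness γ g) (β : Below γ.1) {η : List Ordinal.{u}} (hη : η ∈ p.T)
    (h : ∀ x ∈ η, x < β.1) :
    η ∈ q.T ∧ (∀ i (hi : i < β.1), p.f η ⟨i, hi.trans β.2⟩ = q.f η ⟨i, hi.trans β.2⟩) ∧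
      p.l η = q.l η ∧ p.a η = q.a η := by
  obtain ⟨h1, h2, h3, h4, -⟩ := zfTuple5_inj.1 ((p.spec β).symm.trans (q.spec β))
  obtain ⟨ζ, rfl⟩ := TreeBelow.exists_seq_eq hη h
  refine ⟨?_, ?_, ?_, ?_⟩
  · have hmem : zfList ζ.seq ∈ ZFSet.range fun η : TreeBelow q.T β.1 => zfList η.seq :=
      h1 ▸ ZFSet.mem_range_self (f := fun η : TreeBelow p.T β.1 => zfList η.seq) ζ
    obtain ⟨ξ, hξ⟩ := ZFSet.mem_range.1 hmem
    rw [← zfList_injective hξ]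
    exact ξ.2
  · intro i hi
    obtain ⟨ξ, h5, h6⟩ := zfGraph_eq h2 ζ
    have := congrFun (zfSeq_injective h6) ⟨i, hi⟩
    rw [zfList_injective h5] at this
    exact this.symm
  · obtain ⟨ξ, h5, h6⟩ := zfGraph_eq h3 ζ
    have := zfTruth_injective h6
    rw [zfList_injective h5] at this
    exact this.symm
  · obtain ⟨ξ, h5, h6⟩ := zfGraph_eq h4 ζ
    have := toZFSet_injective h6
    rw [zfList_injective h5] at this
    exact this.symm

theorem eq_of_isSuccLimit (p q : Witness γ g) (hγ : Order.IsSuccLimit γ.1) {η : List Ordinal.{u}}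
    (hη : η ∈ p.T) : η ∈ q.T ∧ p.f η = q.f η ∧ p.l η = q.l η ∧ p.a η = q.a η := by
  obtain ⟨β, hβ, h⟩ := exists_forall_mem_lt hγ (p.lt_of_mem η hη)
  obtain ⟨h1, -, h3, h4⟩ := p.eq_at q ⟨β, hβ⟩ hη h
  refine ⟨h1, funext fun i => ?_, h3, h4⟩
  -- To compare `f η` at `i`, take a stage past `i` and past all entries of `η`; it is below `γ`
  -- because `γ` is a limit.
  exact (p.eq_at q ⟨max (i.1 + 1) β, max_lt (hγ.add_one_lt i.2) hβ⟩ hη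
    fun x hx => lt_max_of_lt_right (h x hx)).2.1 i.1
      (lt_max_of_lt_left (Order.lt_add_one_iff.2 le_rfl))

/-- A root with a child and `a = 0` uses its truth function; as the first projection this returns
the colour and ignores the children. The node `⟨0⟩` of `twoTree` is there only to make the root
nonmaximal. -/
theorem eval_eq (p : Witness γ g) (F : Dom κ (Fin 2) → Fin 2) {η : List Ordinal.{u}}
    (hη : ∃ ν, Child p.T ν η) (ha : p.a η = 0) (hl : p.l η = fun x _ _ => x) :
    p.eval F η = F ⟨γ, p.f η⟩ := by
  rw [eval, p.wf.fix_eq, if_pos ⟨hη, ha ▸ zero_le⟩, hl]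

end Witness

/-! ### `F^⊗` codes the sets coded by `F` -/

/-- The tree consisting of the root and the node `⟨0⟩`. -/
def twoTree : Set (List Ordinal.{u}) := {[], [0]}

instance (β : Ordinal.{u}) : Finite (TreeBelow twoTree β) := by
  have hfin : Finite (twoTree : Set (List Ordinal.{u})) := ((finite_singleton _).insert _).to_subtype
  refine Finite.of_injective (β := (twoTree : Set (List Ordinal.{u}))) (fun η => ⟨η.seq, η.2⟩) ?_
  intro η ζ h
  exact Subtype.ext (List.map_injective_iff.2 Subtype.val_injective (congrArg Subtype.val h))

/-- The `β`-th term of a standard sequence on `twoTree` whose evaluation at the root is `F (f ↾ γ)`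
at every `γ`. -/
def twoTreeTerm (f : Below κ.ord → Fin 2) (β : Below κ.ord) : ZFSet.{u} :=
  zfTuple5 (ZFSet.range fun η : TreeBelow twoTree β.1 => zfList η.seq)
    (zfGraph (fun η : TreeBelow twoTree β.1 => zfList η.seq) fun _ => zfSeq (restr f β).2)
    (zfGraph (fun η : TreeBelow twoTree β.1 => zfList η.seq) fun _ => zfTruth fun x _ _ => x)
    (zfGraph (fun η : TreeBelow twoTree β.1 => zfList η.seq) fun _ => (0 : Ordinal.{u}).toZFSet)
    (zfGraph (fun η : TreeBelow twoTree β.1 => zfList η.seq) fun _ => zfSub 0 ∅)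

theorem hereditarily_twoTreeTerm (hκ : ℵ₀ ≤ κ) (f : Below κ.ord → Fin 2) (β : Below κ.ord) :
    (twoTreeTerm f β).Hereditarily fun y => y.card < κ := by
  have hl : ∀ η : TreeBelow twoTree β.1, (zfList η.seq).Hereditarily fun y => y.card < κ :=
    fun η => hereditarily_zfList hκ fun x hx => by
      obtain ⟨y, -, rfl⟩ := List.mem_map.1 hx
      exact (mem_Iio.1 y.2).trans β.2
  exact hereditarily_pair hκ (hereditarily_range_of_finite hκ hl) <| hereditarily_pair hκ
    (hereditarily_zfGraph_of_finite hκ hl fun _ => hereditarily_zfSeq hκ β.2 _) <|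
    hereditarily_pair hκ
    (hereditarily_zfGraph_of_finite hκ hl fun _ => hereditarily_zfTruth hκ _) <|
    hereditarily_pair hκ
    (hereditarily_zfGraph_of_finite hκ hl fun _ => hereditarily_toZFSet (zero_lt_ord hκ))
    (hereditarily_zfGraph_of_finite hκ hl fun _ => hereditarily_zfSub (zero_lt_ord hκ) _)

/-- The sequence of the terms `twoTreeTerm f β`. -/
def twoTreeSeq (hκ : ℵ₀ ≤ κ) (f : Below κ.ord → Fin 2) (β : Below κ.ord) : HSet κ :=
  ⟨twoTreeTerm f β, hereditarily_twoTreeTerm hκ f β⟩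

theorem child_twoTree {ν η : List Ordinal.{u}} (h : Child twoTree ν η) : η = [] := by
  obtain ⟨hν, β, rfl⟩ := h
  rcases hν with h | h
  · simp at h
  · cases η with
    | nil => rfl
    | cons x η => simp at h

theorem wf_child_twoTree : WellFounded (Child twoTree.{u}) := by
  have h0 : ∀ η : List Ordinal.{u}, η ≠ [] → Acc (Child twoTree) η :=
    fun η hη => ⟨_, fun ν hν => absurd (child_twoTree hν) hη⟩
  refine ⟨fun η => ⟨_, fun ν hν => h0 ν ?_⟩⟩
  obtain ⟨-, β, rfl⟩ := hν
  simp

/-- The witness that an initial segment of `twoTreeSeq` is standard. -/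
def twoTreeWitness (hκ : ℵ₀ ≤ κ) (f : Below κ.ord → Fin 2) (δ : Below κ.ord) (hδ : 0 < δ.1) :
    Witness δ (restr (twoTreeSeq hκ f) δ).2 where
  T := twoTree
  lt_of_mem := by
    rintro η (rfl | rfl) x hx
    · simp at hx
    · rwa [List.mem_singleton.1 hx]
  nil_mem := Or.inl rfl
  mem_of_prefix := by
    rintro η (rfl | rfl) ν hν
    · exact Or.inl (List.prefix_nil.1 hν)
    · rcases List.prefix_cons_iff.1 hν with rfl | ⟨t, rfl, ht⟩
      · exact Or.inl rfl
      · exact Or.inr (by rw [List.prefix_nil.1 ht]; rfl)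
  wf := wf_child_twoTree
  f _ := (restr f δ).2
  l _ x _ _ := x
  a _ := 0
  a_lt _ _ := zero_lt_ord hκ
  A _ := ∅
  A_subset _ _ := empty_subset _
  spec _ := rfl

/-- `G` may evaluate an unknown witness `q`; at a limit `δ` it agrees with `twoTreeWitness` in all
the data that matter at the root. -/
theorem IsOtimes.twoTreeSeq_eq (hκ : ℵ₀ ≤ κ) {F : Dom κ (Fin 2) → Fin 2}
    {G : Dom κ (HSet κ) → Fin 2} (hG : IsOtimes F G) (f : Below κ.ord → Fin 2) {δ : Below κ.ord}
    (hδ : Order.IsSuccLimit δ.1) : G (restr (twoTreeSeq hκ f) δ) = F (restr f δ) := by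
  let p := twoTreeWitness hκ f δ hδ.bot_lt
  obtain ⟨q, hq⟩ := hG.standard (restr (twoTreeSeq hκ f) δ) hδ.bot_lt ⟨p⟩
  have hp0 : ([0] : List Ordinal.{u}) ∈ p.T := Or.inr rfl
  obtain ⟨-, hf, hl, ha⟩ := p.eq_of_isSuccLimit q hδ p.nil_mem
  rw [hq, q.eval_eq F ⟨[0], (p.eq_of_isSuccLimit q hδ hp0).1, 0, rfl⟩ ha.symm hl.symm, ← hf]
  rfl

theorem IsOtimes.codedPlus_colour (hκ : ℵ₀ < κ) {F : Dom κ (Fin 2) → Fin 2}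
    {G : Dom κ (HSet κ) → Fin 2} (hG : IsOtimes F G) (f : Below κ.ord → Fin 2) :
    codedPlus G {δ | F (restr f δ) = 1} := by
  refine codedPlus_of_diff hκ.le
    (WeakDiamond.codedPlus_colour (F := G) hκ (twoTreeSeq hκ.le f))
    (ID1_mono (not_isSuccLimit_mem_ID1 hκ.le) ?_) (ID1_mono (not_isSuccLimit_mem_ID1 hκ.le) ?_)
  all_goals
    rintro δ ⟨h1, h2⟩ hδ
    simp only [mem_ofPred_eq, hG.twoTreeSeq_eq hκ.le f hδ] at h1 h2
    exact h2 h1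

/-! ### Transfer along the order of colourings -/

theorem InitSeg.eq_of_lh_eq {s t : Dom κ X} (h : InitSeg s t) (hl : lh s = lh t) : s = t := by
  obtain ⟨α, s⟩ := s
  obtain ⟨β, t⟩ := t
  obtain rfl : α = β := Subtype.ext hl
  obtain ⟨_, h⟩ := h
  exact congrArg (Sigma.mk α) (funext h)

theorem initSeg_restr (f : Below κ.ord → X) {α β : Below κ.ord} (h : α ≤ β) :
    InitSeg (restr f α) (restr f β) :=
  ⟨h, fun _ => rfl⟩

/-- The map `h` carries `f` to the limit `g` of the `h (f ↾ α)`, and at almost every `δ` one has `h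
(f ↾ δ) = g ↾ δ`, so that `F₁` along `f` agrees with `F` along `g`. If the limit has length below
`κ`, then `F₁` is eventually 0 along `f` and the set is bounded. -/
theorem ColLE.codedPlus_colour (hκ : ℵ₀ < κ) {F₁ F : Dom κ (Fin 2) → Fin 2} (hF : ColLE F₁ F)
    {G : Dom κ (HSet κ) → Fin 2} (hG : IsOtimes F G) (f : Below κ.ord → Fin 2) :
    codedPlus G {δ | F₁ (restr f δ) = 1} := by
  obtain ⟨h, hmono, hlim, heq, hbdd⟩ := hF
  by_cases hb : ∃ ζ < κ.ord, ∀ α, lh (h (restr f α)) ≤ ζ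
  · obtain ⟨α₀, hα₀⟩ := hbdd f hb
    refine codedPlus_of_mem_ID1 (ID1_mono (Iio_mem_ID1 hκ.le α₀) fun δ hδ => ?_)
    by_contra hδ'
    rw [mem_ofPred_eq, hα₀ δ (not_lt.1 hδ')] at hδ
    exact zero_ne_one hδ
  · push Not at hb
    choose φ hφ using fun ξ : Below κ.ord => hb ξ.1 ξ.2
    let g : Below κ.ord → Fin 2 := fun ξ => (h (restr f (φ ξ))).2 ⟨ξ.1, hφ ξ⟩
    -- Closure under `α ↦ lh (h (f ↾ α))` and continuity of `h` at limits give `lh (h (f ↾ δ)) ≤ δ`;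
    -- closure under `φ` gives the reverse inequality.
    have key : ∀ δ : Below κ.ord, Order.IsSuccLimit δ.1 → (¬ ∃ α < δ, δ ≤ φ α) →
        (¬ ∃ α < δ, δ ≤ (h (restr f α)).1) → F₁ (restr f δ) = F (restr g δ) := by
      intro δ hδ h1 h2
      push Not at h1 h2
      have hle : lh (h (restr f δ)) ≤ δ.1 := by
        by_contra hlt
        obtain ⟨α, hα⟩ := hlim (restr f δ) hδ δ.1 (not_le.1 hlt)
        exact lt_asymm hα (h2 ⟨α.1, lt_trans (mem_Iio.1 α.2) (mem_Iio.1 δ.2)⟩ α.2)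
      have hseg : ∀ ξ < δ, InitSeg (h (restr f (φ ξ))) (h (restr f δ)) := fun ξ hξ =>
        hmono _ _ (initSeg_restr f (h1 ξ hξ).le)
      have hge : δ.1 ≤ lh (h (restr f δ)) := by
        by_contra hlt
        exact lt_irrefl _ ((hφ (h (restr f δ)).1).trans_le (hseg _ (not_le.1 hlt)).1)
      have hg : InitSeg (restr g δ) (h (restr f δ)) :=
        ⟨hge, fun i => (hseg ⟨i.1, lt_trans (mem_Iio.1 i.2) (mem_Iio.1 δ.2)⟩ i.2).2 _⟩
      rw [hg.eq_of_lh_eq (le_antisymm hge hle)]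
      exact heq _ hδ.bot_lt (le_antisymm hge hle)
    have hbad := ID1_union hκ.le (not_isSuccLimit_mem_ID1 (F := G) hκ.le) (ID1_union hκ.le
      (not_closed_mem_ID1 hκ.le φ) (not_closed_mem_ID1 hκ.le fun α => (h (restr f α)).1))
    refine codedPlus_of_diff hκ.le (hG.codedPlus_colour hκ g) (ID1_mono hbad ?_)
      (ID1_mono hbad ?_)
    all_goals
      rintro δ ⟨h3, h4⟩
      by_contra h5
      simp only [mem_union, mem_ofPred_eq, not_or, not_not] at h5
      rw [mem_ofPred_eq] at h3 h4
      simp only [key δ h5.1 h5.2.1 h5.2.2] at h3 h4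
      exact h4 h3

/-! ### Weak diamond sequences -/

theorem exists_isWeakDiamond (hκ : ℵ₀ < κ) {Ftr : Dom κ (Fin 2) → Fin 3}
    {F : Dom κ (Fin 2) → Fin 2} (hF : ∀ i : Fin 3, ColLE (colourInd Ftr i) F)
    {G : Dom κ (HSet κ) → Fin 2} (hG : IsOtimes F G) (hsat : IsSaturated (ID G))
    {S : Set (Below κ.ord)} (hS : codedPlus G S) (hS' : S ∉ ID2 G) :
    ∃ η : S → Fin 3, IsWeakDiamond Ftr S η := by
  obtain ⟨D, hDS, hD, hD', A, hdisj, hA⟩ :=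
    exists_three_dense_of_notMem_ID2 hκ.le (hsat.mono (ID_subset_ID1 hκ)) hS hS'
  -- The default 0 off the `A i` is harmless: only points of the sets `A i` enter the argument.
  let η : Below κ.ord → Fin 3 := fun δ => if h : ∃ i, δ ∈ A i then h.choose else 0
  have hη : ∀ i, ∀ δ ∈ A i, η δ = i := by
    intro i δ hδ
    have h : ∃ i, δ ∈ A i := ⟨i, hδ⟩
    by_contra hne
    refine disjoint_left.1 (hdisj hne) ?_ hδ
    simp only [η, dif_pos h]
    exact h.choose_spec
  refine ⟨fun δ => η δ.1, fun f => ?_⟩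
  by_contra hns
  have hY : ∀ i, D ∩ {δ | Ftr (restr f δ) = i} ∈ ID1 G := by
    intro i
    have hc : codedPlus G {δ | Ftr (restr f δ) = i} := by
      simpa [colourInd] using (hF i).codedPlus_colour hκ hG f
    refine hA i _ inter_subset_left (hD.inter hκ.le hc) (ID1_mono (ID1_of_nonstat hns) ?_)
    rintro δ ⟨⟨h1, h2⟩, h3⟩
    exact ⟨hDS h1, (hη i δ h3).trans h2.symm⟩
  refine hD' (ID1_mono (ID1_union hκ.le (hY 0) (ID1_union hκ.le (hY 1) (hY 2))) fun δ hδ => ?_)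
  have : ∀ i : Fin 3, i = 0 ∨ i = 1 ∨ i = 2 := by decide
  rcases this (Ftr (restr f δ)) with h | h | h
  · exact Or.inl ⟨hδ, h⟩
  · exact Or.inr (Or.inl ⟨hδ, h⟩)
  · exact Or.inr (Or.inr ⟨hδ, h⟩)

end

end WeakDiamond

open WeakDiamond
theorem theorem2p6 (κ : Cardinal.{u}) (hreg : κ.IsRegular) (hunc : ℵ₀ < κ)
    (Ftr : Dom κ (Fin 2) → Fin 3) (F : Dom κ (Fin 2) → Fin 2)
    (hF : ∀ i : Fin 3, ColLE (colourInd Ftr i) F)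
    (G : Dom κ (HSet κ) → Fin 2) (hG : IsOtimes F G)
    (h2 : Set.univ ∉ ID2 G) (hsat : IsSaturated (ID G)) :
    (∃ η : ↥(Set.univ : Set (Below κ.ord)) → Fin 3, IsWeakDiamond Ftr Set.univ η) ∧
    ∀ S ∈ coded G, S ∉ ID2 G → ∃ η : ↥S → Fin 3, IsWeakDiamond Ftr S η :=
  ⟨exists_isWeakDiamond hunc hF hG hsat .univ h2,
    fun S hS hS' => exists_isWeakDiamond hunc hF hG hsat (.basic S hS) hS'⟩
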